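/- Let $V$ be a complex Hilbert space with inner product $\langle\cdot,\cdot\rangle$ (antilinear in the first argument) and let $\overline{\,\cdot\,}$ be a continuous antilinear involution on $V$ with $\overline{\langle v,w\rangle}=\langle\overline v,\overline w\rangle$ for all $v,w\in V$. Let $V'_h$ be the real Banach space (with the operator norm) of all continuous linear functionals $\rho\colon V\to\mathbb C$ with $\overline{\rho(v)}=\rho(\overline v)$ for all $v\in V$. For every continuous positive semidefinite Hermitian form $\langle\cdot,\cdot\rangle_\alpha$ on $V$ let $\langle\cdot,\cdot\rangle_\alpha^\bullet$ be the positive Hermitian form on the algebraic tensor space $\mathcal T^\bullet(V)=\bigoplus_{k\ge 0}V^{\otimes k}$ for which tensors of different degrees are orthogonal and $$\langle x_1\otimes\cdots\otimes x_k,\;y_1\otimes\cdots\otimes y_k\rangle_\alpha^\bullet=k!\prod_{m=1}^k\langle x_m,y_m\rangle_\alpha .$$ Give $\mathcal T^\bullet(V)$ the locally convex topology of all the seminorms $X\mapsto\sqrt{\langle X,X\rangle_\alpha^\bullet}$. Let $\mathcal S^\bullet(V)\subseteq\mathcal T^\bullet(V)$ be the subspace of symmetric tensors, i.e. the image of the symmetrisation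 operator $x_1\otimes\cdots\otimes x_k\mapsto\frac1{k!}\sum_{\sigma\in\mathfrak S_k}x_{\sigma(1)}\otimes\cdots\otimes x_{\sigma(k)}$, with the subspace topology, and let $\mathcal S^\bullet(V)^{\mathrm{cpl}}$ be its completion. For $\rho\in V'_h$ let $D_\rho$ be the linear map on $\mathcal T^\bullet(V)$ that vanishes in degree $0$ and satisfies $D_\rho(x_1\otimes\cdots\otimes x_k)=k\,\rho(x_k)\,x_1\otimes\cdots\otimes x_{k-1}$ for $k\ge1$; let $\tau^*_\rho=\sum_{t\ge0}\frac1{t!}(D_\rho)^t$, and let $\delta_\rho(X)\in\mathbb C$ be the degree-$0$ component of $\tau^*_\rho(X)$. The functional $\delta_\rho$ is continuous; denote the continuous extension to $\mathcal S^\bullet(V)^{\mathrm{cpl}}$ of its restriction to $\mathcal S^\bullet(V)$ again by $\delta_\rho$. The Gel'fand transform of $X\in\mathcal S^\bullet(V)^{\mathrm{cpl}}$ is the function $\widehat X\colon V'_h\to\mathbb C$, $\widehat X(\rho)=\delta_\rho(X)$. Then for every $X\in\mathcal S^\bullet(V)^{\mathrm{cpl}}$ the function $\widehat X\colon V'_h\to\mathbb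 C$ is smooth in the Fréchet sense, i.e. infinitely often Fréchet differentiable on the real Banach space $V'_h$. -/

import Mathlib

noncomputable section

open scoped TensorProduct DirectSum Nat

namespace HilbertTensor

/-! ### Continuous positive Hermitian forms -/

/-- A continuous positive Hermitian form on a complex topological vector space `V`:
sesquilinear (antilinear in the first, linear in the second argument), Hermitian, positive
semidefinite, and jointly continuous. -/
structure PosHermForm (V : Type*) [AddCommGroup V] [Module ℂ V] [TopologicalSpace V] where
  form : V →ₗ⋆[ℂ] V →ₗ[ℂ] ℂ
  conj_symm : ∀ v w, (starRingEnd ℂ) (form w v) = form v w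
  nonneg : ∀ v, 0 ≤ (form v v).re
  continuous' : Continuous fun p : V × V => form p.1 p.2

/-! ### The tensor algebra and the extension of positive Hermitian forms -/

/-- The vector space `⨁ k, V^{⊗ k}` underlying the tensor algebra of `V`. -/
abbrev TensorSpace (V : Type*) [AddCommGroup V] [Module ℂ V] : Type _ :=
  ⨁ k : ℕ, ⨂[ℂ]^k V

section Algebraic

variable {V : Type*} [AddCommGroup V] [Module ℂ V]

/-- The inclusion of the tensors of degree `k`. -/
def incl (k : ℕ) : (⨂[ℂ]^k V) →ₗ[ℂ] TensorSpace V :=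
  DirectSum.lof ℂ ℕ (fun k => ⨂[ℂ]^k V) k

/-- The projection onto the tensors of degree `k`. -/
def proj (k : ℕ) : TensorSpace V →ₗ[ℂ] (⨂[ℂ]^k V) :=
  DirectSum.component ℂ ℕ (fun k => ⨂[ℂ]^k V) k

/-- The linear map on `⨁ k, V^{⊗ k}` given by linear maps on all the summands. -/
def ofDegrees {W : Type*} [AddCommGroup W] [Module ℂ W] (f : ∀ k : ℕ, (⨂[ℂ]^k V) →ₗ[ℂ] W) :
    TensorSpace V →ₗ[ℂ] W :=
  DirectSum.toModule ℂ ℕ W f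

theorem ofDegrees_incl {W : Type*} [AddCommGroup W] [Module ℂ W]
    (f : ∀ k : ℕ, (⨂[ℂ]^k V) →ₗ[ℂ] W) (k : ℕ) (x : ⨂[ℂ]^k V) :
    ofDegrees f (incl k x) = f k x :=
  by simp [ofDegrees, incl]

theorem proj_incl_self (k : ℕ) (x : ⨂[ℂ]^k V) : proj k (incl k x) = x :=
  by simp [proj, incl]

theorem proj_incl_ne {k l : ℕ} (h : k ≠ l) (x : ⨂[ℂ]^k V) : proj l (incl k x) = 0 := by
  simp only [proj, incl, DirectSum.component.of]
  rw [dif_neg h]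

theorem exists_sum_incl (X : TensorSpace V) :
    ∃ s : Finset ℕ, X = ∑ k ∈ s, incl k (proj k X) := by
  classical
  exact ⟨_, (DirectSum.sum_support_of (β := fun k : ℕ => ⨂[ℂ]^k V) X).symm⟩

theorem tensorSpace_induction {p : TensorSpace V → Prop} (X : TensorSpace V)
    (incl_tprod : ∀ k (x : Fin k → V), p (incl k (PiTensorProduct.tprod ℂ x)))
    (smul : ∀ (c : ℂ) X, p X → p (c • X)) (add : ∀ X Y, p X → p Y → p (X + Y)) : p X := by
  have h0 : p 0 := by
    simpa using smul 0 _ (incl_tprod 0 Fin.elim0)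
  have hk : ∀ k (x : ⨂[ℂ]^k V), p (incl k x) := by
    intro k x
    induction x using PiTensorProduct.induction_on with
    | smul_tprod r f => simpa using smul r _ (incl_tprod k f)
    | add x y hx hy => simpa using add _ _ hx hy
  obtain ⟨s, hs⟩ := exists_sum_incl X
  rw [hs]
  exact Finset.sum_induction _ p add h0 fun k _ => hk k _

/-- For linear functionals `η₁, …, η_k` on `V`, the linear functional on `V^{⊗ k}` with
`x₁ ⊗ ⋯ ⊗ x_k ↦ η₁ (x₁) ⋯ η_k (x_k)`. -/
def tensorFunctional (k : ℕ) :
    MultilinearMap ℂ (fun _ : Fin k => V →ₗ[ℂ] ℂ) ((⨂[ℂ]^k V) →ₗ[ℂ] ℂ) :=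
  (PiTensorProduct.lift (R := ℂ) (s := fun _ : Fin k => V) (E := ℂ)).toLinearMap.compMultilinearMap
    (MultilinearMap.piLinearMap (MultilinearMap.mkPiAlgebra ℂ (Fin k) ℂ))

theorem tensorFunctional_tprod (k : ℕ) (η : Fin k → V →ₗ[ℂ] ℂ) (x : Fin k → V) :
    tensorFunctional k η (PiTensorProduct.tprod ℂ x) = ∏ m, η m (x m) := by
  simp [tensorFunctional]

/-- For `y ∈ V^k`, the antilinear functional on `V^{⊗ k}` with
`x₁ ⊗ ⋯ ⊗ x_k ↦ k! ∏ₘ conj (α (yₘ, xₘ))`. -/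
def degreeFormAux (α : V →ₗ⋆[ℂ] V →ₗ[ℂ] ℂ) (k : ℕ) (y : Fin k → V) : (⨂[ℂ]^k V) →ₗ⋆[ℂ] ℂ where
  toFun X := k ! * (starRingEnd ℂ) (tensorFunctional k (fun m => α (y m)) X)
  map_add' X Y := by simp only [map_add, mul_add]
  map_smul' c X := by simp only [map_smul, smul_eq_mul, map_mul]; ring

/-- For Hermitian `α`, the sesquilinear form on `V^{⊗ k}` with
`⟨x₁ ⊗ ⋯ ⊗ x_k, y₁ ⊗ ⋯ ⊗ y_k⟩ = k! ∏ₘ α (xₘ, yₘ)`. -/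
def degreeForm (α : V →ₗ⋆[ℂ] V →ₗ[ℂ] ℂ) (k : ℕ) :
    (⨂[ℂ]^k V) →ₗ⋆[ℂ] (⨂[ℂ]^k V) →ₗ[ℂ] ℂ :=
  LinearMap.flip (PiTensorProduct.lift
    { toFun := degreeFormAux α k
      map_update_add' := by
        intro _ y m v w
        have h : ∀ u, (fun j => α (Function.update y m u j)) =
            Function.update (fun j => α (y j)) m (α u) := fun u => by
          ext1 j; rcases eq_or_ne j m with rfl | hj <;> simp [*]
        refine LinearMap.ext fun X => ?_
        simp only [degreeFormAux, LinearMap.coe_mk, AddHom.coe_mk, LinearMap.add_apply, h, map_add,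
          MultilinearMap.map_update_add, mul_add]
      map_update_smul' := by
        intro _ y m c v
        have h : ∀ u, (fun j => α (Function.update y m u j)) =
            Function.update (fun j => α (y j)) m (α u) := fun u => by
          ext1 j; rcases eq_or_ne j m with rfl | hj <;> simp [*]
        refine LinearMap.ext fun X => ?_
        simp only [degreeFormAux, LinearMap.coe_mk, AddHom.coe_mk, LinearMap.smul_apply, h,
          LinearMap.map_smulₛₗ, MultilinearMap.map_update_smul, smul_eq_mul, map_mul,
          Complex.conj_conj]
        ring })

theorem degreeForm_tprod (α : V →ₗ⋆[ℂ] V →ₗ[ℂ] ℂ) (hα : ∀ v w, (starRingEnd ℂ) (α w v) = α v w)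
    (k : ℕ) (x y : Fin k → V) :
    degreeForm α k (PiTensorProduct.tprod ℂ x) (PiTensorProduct.tprod ℂ y) =
      k ! * ∏ m, α (x m) (y m) := by
  simp [degreeForm, degreeFormAux, tensorFunctional_tprod, hα]

/-- The sesquilinear form `⟨X, Y⟩ = ∑ₖ ⟨Xₖ, Yₖ⟩` on `⨁ k, V^{⊗ k}`. -/
def tensorForm (α : V →ₗ⋆[ℂ] V →ₗ[ℂ] ℂ) : TensorSpace V →ₗ⋆[ℂ] TensorSpace V →ₗ[ℂ] ℂ :=
  LinearMap.flip (ofDegrees fun k => LinearMap.flip ((degreeForm α k).comp (proj k)))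

theorem tensorForm_incl (α : V →ₗ⋆[ℂ] V →ₗ[ℂ] ℂ) (k : ℕ) (X : TensorSpace V) (y : ⨂[ℂ]^k V) :
    tensorForm α X (incl k y) = degreeForm α k (proj k X) y := by
  simp [tensorForm, ofDegrees_incl]

theorem tensorForm_eq_sum (α : V →ₗ⋆[ℂ] V →ₗ[ℂ] ℂ) (X Y : TensorSpace V) (s : Finset ℕ)
    (hs : Y = ∑ k ∈ s, incl k (proj k Y)) :
    tensorForm α X Y = ∑ k ∈ s, degreeForm α k (proj k X) (proj k Y) := by
  conv_lhs => rw [hs]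
  simp only [map_sum, tensorForm_incl]

open scoped ComplexOrder in
theorem posSemidef_prod {ι : Type*} [Finite ι] (k : ℕ) (M : Fin k → Matrix ι ι ℂ)
    (hM : ∀ m, (M m).PosSemidef) :
    (Matrix.of fun i j => ∏ m, M m i j).PosSemidef := by
  induction k with
  | zero =>
    have h : (Matrix.of fun i j => ∏ m, M m i j) = Matrix.vecMulVec 1 (star 1) := by
      ext i j; simp [Matrix.vecMulVec_apply]
    rw [h]
    exact Matrix.posSemidef_vecMulVec_self_star _
  | succ k ih =>
    have h : (Matrix.of fun i j => ∏ m, M m i j) =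
        Matrix.hadamard (M 0) (Matrix.of fun i j => ∏ m : Fin k, M m.succ i j) := by
      ext i j; simp [Fin.prod_univ_succ]
    rw [h]
    exact (hM 0).hadamard (ih _ fun m => hM m.succ)

end Algebraic

section Topological

variable {V : Type*} [AddCommGroup V] [Module ℂ V] [TopologicalSpace V]

theorem degreeForm_conj_symm (α : PosHermForm V) (k : ℕ) (X Y : ⨂[ℂ]^k V) :
    (starRingEnd ℂ) (degreeForm α.form k Y X) = degreeForm α.form k X Y := by
  induction X using PiTensorProduct.induction_on with
  | smul_tprod r x =>
    induction Y using PiTensorProduct.induction_on with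
    | smul_tprod s y =>
      simp [LinearMap.map_smulₛₗ, degreeForm_tprod α.form α.conj_symm, α.conj_symm]
      ring
    | add Y Y' h h' => simp only [map_add, LinearMap.add_apply, h, h']
  | add X X' h h' => simp only [map_add, LinearMap.add_apply, h, h']

open scoped ComplexOrder in
theorem posSemidef_gram (α : PosHermForm V) {ι : Type*} [Fintype ι] (v : ι → V) :
    (Matrix.of fun i j => α.form (v i) (v j)).PosSemidef := by
  refine Matrix.PosSemidef.of_dotProduct_mulVec_nonneg ?_ fun a => ?_
  · ext i j
    simp [α.conj_symm]
  · have h : star a ⬝ᵥ (Matrix.of fun i j => α.form (v i) (v j)).mulVec a =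
        α.form (∑ i, a i • v i) (∑ i, a i • v i) := by
      simp only [dotProduct, Matrix.mulVec, Finset.mul_sum, LinearMap.map_smulₛₗ, map_sum,
        LinearMap.sum_apply, LinearMap.smul_apply, smul_eq_mul, Matrix.of_apply, Pi.star_apply,
        RCLike.star_def, RingHom.id_apply]
      rw [Finset.sum_comm]
      exact Finset.sum_congr rfl fun i _ => Finset.sum_congr rfl fun j _ => by ring
    rw [h, Complex.nonneg_iff]
    refine ⟨α.nonneg _, ?_⟩
    have := congrArg Complex.im (α.conj_symm (∑ i, a i • v i) (∑ i, a i • v i))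
    rw [Complex.conj_im] at this
    linarith

open scoped ComplexOrder in
theorem degreeForm_nonneg (α : PosHermForm V) (k : ℕ) (X : ⨂[ℂ]^k V) :
    0 ≤ (degreeForm α.form k X X).re := by
  classical
  have hX : X ∈ Submodule.span ℂ (Set.range (PiTensorProduct.tprod ℂ (s := fun _ : Fin k => V))) := by
    rw [PiTensorProduct.span_tprod_eq_top]; trivial
  obtain ⟨c, rfl⟩ := Finsupp.mem_span_range_iff_exists_finsupp.1 hX
  have h := (posSemidef_prod k _ fun m =>
    posSemidef_gram α fun x : c.support => (x : Fin k → V) m).dotProduct_mulVec_nonneg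
      fun x => c x
  have h2 : degreeForm α.form k (c.sum fun x a => a • PiTensorProduct.tprod ℂ x)
      (c.sum fun x a => a • PiTensorProduct.tprod ℂ x) = k ! * (star (fun x : c.support => c x) ⬝ᵥ
      (Matrix.of fun i j : c.support => ∏ m,
        (Matrix.of fun i j : c.support => α.form (i.1 m) (j.1 m)) i j).mulVec fun x => c x) := by
    rw [Finsupp.sum, ← Finset.sum_attach]
    simp only [dotProduct, Matrix.mulVec, Finset.mul_sum, LinearMap.map_smulₛₗ, map_sum,
      LinearMap.sum_apply, LinearMap.smul_apply, smul_eq_mul, Matrix.of_apply, Pi.star_apply,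
      RCLike.star_def, RingHom.id_apply, degreeForm_tprod α.form α.conj_symm]
    rw [Finset.sum_comm]
    exact Finset.sum_congr rfl fun i _ => Finset.sum_congr rfl fun j _ => by ring
  rw [h2]
  have h3 : (0 : ℂ) ≤ (k ! : ℂ) := by positivity
  exact (Complex.nonneg_iff.1 (mul_nonneg h3 h)).1

theorem tensorForm_conj_symm (α : PosHermForm V) (X Y : TensorSpace V) :
    (starRingEnd ℂ) (tensorForm α.form Y X) = tensorForm α.form X Y := by
  obtain ⟨s, hs⟩ := exists_sum_incl X
  obtain ⟨t, ht⟩ := exists_sum_incl Y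
  have key : ∀ (i j : ℕ) (x : ⨂[ℂ]^i V) (y : ⨂[ℂ]^j V),
      (starRingEnd ℂ) (tensorForm α.form (incl j y) (incl i x)) =
        tensorForm α.form (incl i x) (incl j y) := by
    intro i j x y
    rw [tensorForm_incl, tensorForm_incl]
    rcases eq_or_ne i j with rfl | h
    · rw [proj_incl_self, proj_incl_self, degreeForm_conj_symm]
    · rw [proj_incl_ne h, proj_incl_ne h.symm]; simp
  rw [hs, ht]
  simp only [map_sum, LinearMap.sum_apply, key]
  exact Finset.sum_comm

theorem tensorForm_nonneg (α : PosHermForm V) (X : TensorSpace V) :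
    0 ≤ (tensorForm α.form X X).re := by
  obtain ⟨s, hs⟩ := exists_sum_incl X
  rw [tensorForm_eq_sum α.form X X s hs, Complex.re_sum]
  exact Finset.sum_nonneg fun k _ => degreeForm_nonneg α k _

/-- The positive Hermitian form extending `α` to `⨁ k, V^{⊗ k}`, as a semi-inner product. -/
@[reducible] def tensorCore (α : PosHermForm V) : PreInnerProductSpace.Core ℂ (TensorSpace V) where
  inner X Y := tensorForm α.form X Y
  conj_inner_symm := tensorForm_conj_symm α
  re_inner_nonneg := tensorForm_nonneg α
  add_left X Y Z := by simp
  smul_left X Y r := by simp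

/-- The seminorm `‖X‖ = √⟨X, X⟩` on `⨁ k, V^{⊗ k}` given by the extension of `α`. -/
def tensorSeminorm (α : PosHermForm V) : Seminorm ℂ (TensorSpace V) :=
  Seminorm.of (fun X => √(tensorForm α.form X X).re)
    (by
      let := tensorCore α
      let := InnerProductSpace.Core.toSeminormedAddCommGroup (𝕜 := ℂ) (F := TensorSpace V)
      exact fun X Y => norm_add_le X Y)
    (by
      let := tensorCore α
      let := InnerProductSpace.Core.toSeminormedAddCommGroup (𝕜 := ℂ) (F := TensorSpace V)
      let := InnerProductSpace.Core.toNormedSpace (𝕜 := ℂ) (F := TensorSpace V)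
      exact fun a X => norm_smul a X)

theorem tensorSeminorm_apply (α : PosHermForm V) (X : TensorSpace V) :
    tensorSeminorm α X = √(tensorForm α.form X X).re := rfl

/-- The locally convex (uniform) structure on `⨁ k, V^{⊗ k}` defined by the seminorms that come
from all continuous positive Hermitian forms on `V`. -/
instance : UniformSpace (TensorSpace V) :=
  ⨅ α : PosHermForm V, (tensorSeminorm α).toSeminormedAddCommGroup.toUniformSpace

instance : IsUniformAddGroup (TensorSpace V) :=
  isUniformAddGroup_iInf fun α =>
    @SeminormedAddCommGroup.to_isUniformAddGroup _ (tensorSeminorm α).toSeminormedAddCommGroup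

end Topological

/-! ### Symmetric tensors -/

section Symmetric

variable (V : Type*) [AddCommGroup V] [Module ℂ V]

/-- The symmetrisation of tensors of degree `k`,
`x₁ ⊗ ⋯ ⊗ x_k ↦ (1 / k!) ∑_σ x_{σ 1} ⊗ ⋯ ⊗ x_{σ k}`. -/
def symmDegree (k : ℕ) : (⨂[ℂ]^k V) →ₗ[ℂ] (⨂[ℂ]^k V) :=
  (k ! : ℂ)⁻¹ • ∑ σ : Equiv.Perm (Fin k), PiTensorProduct.lift
    ((PiTensorProduct.tprod ℂ (s := fun _ : Fin k => V)).domDomCongr σ)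

/-- The symmetrisation operator on `⨁ k, V^{⊗ k}`. -/
def symmetrisation : TensorSpace V →ₗ[ℂ] TensorSpace V :=
  ofDegrees fun k => incl k ∘ₗ symmDegree V k

/-- The space of symmetric tensors, the image of the symmetrisation operator. With `V` a
topological vector space, it carries the subspace topology and uniformity. -/
def SymTensor : Submodule ℂ (TensorSpace V) := LinearMap.range (symmetrisation V)

instance [TopologicalSpace V] : IsUniformAddGroup (SymTensor V) :=
  (SymTensor V).toAddSubgroup.isUniformAddGroup

/-- The completion of the locally convex space of symmetric tensors. -/
abbrev SymTensorCpl [TopologicalSpace V] : Type _ :=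
  UniformSpace.Completion (SymTensor V)

end Symmetric

/-! ### Derivative, translation and evaluation -/

section Evaluation

variable {V : Type*} [AddCommGroup V] [Module ℂ V]

/-- The degree `k` part of the derivative in direction `ρ`: zero for `k = 0`, and
`x₁ ⊗ ⋯ ⊗ x_k ↦ k ρ(x_k) x₁ ⊗ ⋯ ⊗ x_{k-1}` for `k > 0`. -/
def derivDegree (ρ : V →ₗ[ℂ] ℂ) : ∀ k : ℕ, (⨂[ℂ]^k V) →ₗ[ℂ] TensorSpace V
  | 0 => 0
  | k + 1 => incl k ∘ₗ PiTensorProduct.lift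
      (((k + 1 : ℂ) • LinearMap.smulRightₗ ρ).compMultilinearMap
        (PiTensorProduct.tprod ℂ (s := fun _ : Fin k => V))).uncurryRight

/-- The derivative `D_ρ` in direction `ρ`. -/
def tensorDeriv (ρ : V →ₗ[ℂ] ℂ) : Module.End ℂ (TensorSpace V) :=
  ofDegrees (derivDegree ρ)

theorem tensorDeriv_zero (ρ : V →ₗ[ℂ] ℂ) (x : ⨂[ℂ]^0 V) : tensorDeriv ρ (incl 0 x) = 0 := by
  rw [tensorDeriv, ofDegrees_incl]; rfl

theorem tensorDeriv_succ (ρ : V →ₗ[ℂ] ℂ) (k : ℕ) (x : Fin (k + 1) → V) :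
    tensorDeriv ρ (incl (k + 1) (PiTensorProduct.tprod ℂ x)) =
      ((k + 1 : ℂ) * ρ (x (Fin.last k))) •
        incl k (PiTensorProduct.tprod ℂ fun i : Fin k => x i.castSucc) := by
  rw [tensorDeriv, ofDegrees_incl]
  simp [derivDegree, mul_smul, Fin.init_def]

theorem tensorDeriv_pow (ρ : V →ₗ[ℂ] ℂ) (k t : ℕ) (h : k < t) (x : ⨂[ℂ]^k V) :
    (tensorDeriv ρ ^ t) (incl k x) = 0 := by
  induction k generalizing t with
  | zero =>
    obtain ⟨t, rfl⟩ := Nat.exists_eq_add_of_lt h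
    simp [pow_succ, tensorDeriv_zero]
  | succ k ih =>
    obtain ⟨t, rfl⟩ : ∃ s, t = s + 1 := ⟨t - 1, by omega⟩
    induction x using PiTensorProduct.induction_on with
    | smul_tprod r x =>
      simp only [map_smul, pow_succ, Module.End.mul_apply, tensorDeriv_succ,
        ih t (by omega), smul_zero]
    | add X X' h h' => simp only [map_add, h, h', add_zero]

/-- The translation `τ*_ρ = ∑ₜ (1 / t!) (D_ρ)^t`. On tensors of degree `k`, the terms with `t > k`
vanish. -/
def translation (ρ : V →ₗ[ℂ] ℂ) : TensorSpace V →ₗ[ℂ] TensorSpace V :=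
  ofDegrees fun k => ∑ t ∈ Finset.range (k + 1), (t ! : ℂ)⁻¹ • ((tensorDeriv ρ ^ t) ∘ₗ incl k)

theorem translation_apply (ρ : V →ₗ[ℂ] ℂ) (X : TensorSpace V) :
    translation ρ X = ∑ᶠ t : ℕ, (t ! : ℂ)⁻¹ • (tensorDeriv ρ ^ t) X := by
  obtain ⟨s, hs⟩ := exists_sum_incl X
  have hlt : ∀ k ∈ s, k < s.sup id + 1 := fun k hk =>
    Nat.lt_succ_of_le (Finset.le_sup (f := id) hk)
  have h0 : ∀ t, s.sup id + 1 ≤ t → (tensorDeriv ρ ^ t) X = 0 := fun t ht => by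
    rw [hs, map_sum]
    exact Finset.sum_eq_zero fun k hk => tensorDeriv_pow ρ k t ((hlt k hk).trans_le ht) _
  rw [finsum_eq_sum_of_support_subset (s := Finset.range (s.sup id + 1))]
  · conv_lhs => rw [hs]
    conv_rhs => rw [hs]
    simp only [map_sum, Finset.smul_sum]
    rw [Finset.sum_comm]
    refine Finset.sum_congr rfl fun k hk => ?_
    rw [translation, ofDegrees_incl]
    simp only [LinearMap.sum_apply, LinearMap.smul_apply, LinearMap.comp_apply]
    refine Finset.sum_subset (Finset.range_subset_range.2 (hlt k hk)) fun t _ ht => ?_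
    rw [tensorDeriv_pow ρ k t (by simpa using ht), smul_zero]
  · intro t ht
    by_contra hn
    exact ht (by
      change (t ! : ℂ)⁻¹ • (tensorDeriv ρ ^ t) X = 0
      rw [h0 t (by simpa using hn), smul_zero])

/-- The evaluation at `ρ`, `δ_ρ = ⟨·⟩₀ ∘ τ*_ρ`, with the tensors of degree `0` identified with
`ℂ`. -/
def evalAt (ρ : V →ₗ[ℂ] ℂ) : TensorSpace V →ₗ[ℂ] ℂ :=
  (PiTensorProduct.isEmptyEquiv (Fin 0)).toLinearMap ∘ₗ proj 0 ∘ₗ translation ρ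

theorem proj_tensorDeriv_pow (ρ : V →ₗ[ℂ] ℂ) (k t : ℕ) (h : t < k) (x : Fin k → V) :
    proj 0 ((tensorDeriv ρ ^ t) (incl k (PiTensorProduct.tprod ℂ x))) = 0 := by
  induction t generalizing k with
  | zero => simpa using proj_incl_ne (by omega) _
  | succ t ih =>
    obtain ⟨k, rfl⟩ : ∃ l, k = l + 1 := ⟨k - 1, by omega⟩
    rw [pow_succ, Module.End.mul_apply, tensorDeriv_succ, map_smul, map_smul, ih k (by omega),
      smul_zero]

theorem tensorDeriv_pow_self (ρ : V →ₗ[ℂ] ℂ) (k : ℕ) (x : Fin k → V) :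
    (tensorDeriv ρ ^ k) (incl k (PiTensorProduct.tprod ℂ x)) =
      ((k ! : ℂ) * ∏ m, ρ (x m)) • incl 0 (PiTensorProduct.tprod ℂ Fin.elim0) := by
  induction k with
  | zero => simp [Subsingleton.elim x Fin.elim0]
  | succ k ih =>
    rw [pow_succ, Module.End.mul_apply, tensorDeriv_succ, map_smul, ih, smul_smul,
      Fin.prod_univ_castSucc, Nat.factorial_succ]
    push_cast
    congr 1
    ring

theorem evalAt_incl (ρ : V →ₗ[ℂ] ℂ) (k : ℕ) (x : ⨂[ℂ]^k V) :
    evalAt ρ (incl k x) = tensorFunctional k (fun _ => ρ) x := by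
  induction x using PiTensorProduct.induction_on with
  | smul_tprod r x =>
    rw [map_smul, map_smul, map_smul, tensorFunctional_tprod]
    congr 1
    simp only [evalAt, translation, LinearMap.comp_apply, ofDegrees_incl, LinearMap.sum_apply,
      LinearMap.smul_apply, map_sum, map_smul]
    rw [Finset.sum_range_succ, Finset.sum_eq_zero fun t ht => by
      rw [proj_tensorDeriv_pow ρ k t (Finset.mem_range.1 ht), map_zero, smul_zero],
      tensorDeriv_pow_self, map_smul, proj_incl_self]
    have hk : (k ! : ℂ) ≠ 0 := by exact_mod_cast k.factorial_ne_zero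
    simp [hk]
  | add x y hx hy => simp only [map_add, hx, hy]

end Evaluation

section Gelfand

variable {V : Type*} [AddCommGroup V] [Module ℂ V] [TopologicalSpace V]

/-- The positive Hermitian form `(v, w) ↦ conj (ρ v) ρ w`. -/
def rankOne (ρ : V →L[ℂ] ℂ) : PosHermForm V where
  form := LinearMap.mk₂'ₛₗ (starRingEnd ℂ) (RingHom.id ℂ) (fun v w => (starRingEnd ℂ) (ρ v) * ρ w)
    (by intros; simp [add_mul]) (by intros; simp [mul_assoc]) (by intros; simp [mul_add])
    (by intros; simp; ring)
  conj_symm v w := by simp [mul_comm]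
  nonneg v := by
    simp only [LinearMap.mk₂'ₛₗ_apply, mul_comm, Complex.mul_conj, Complex.ofReal_re]
    exact Complex.normSq_nonneg _
  continuous' := by
    simp only [LinearMap.mk₂'ₛₗ_apply]
    exact (Complex.continuous_conj.comp (ρ.continuous.comp continuous_fst)).mul
      (ρ.continuous.comp continuous_snd)

theorem degreeForm_rankOne (ρ : V →L[ℂ] ℂ) (k : ℕ) (X Y : ⨂[ℂ]^k V) :
    degreeForm (rankOne ρ).form k X Y = k ! *
      ((starRingEnd ℂ) (tensorFunctional k (fun _ => (ρ : V →ₗ[ℂ] ℂ)) X) *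
        tensorFunctional k (fun _ => (ρ : V →ₗ[ℂ] ℂ)) Y) := by
  induction X using PiTensorProduct.induction_on with
  | smul_tprod r x =>
    induction Y using PiTensorProduct.induction_on with
    | smul_tprod s y =>
      simp only [map_smul, LinearMap.map_smulₛₗ, LinearMap.smul_apply, smul_eq_mul, map_mul,
        degreeForm_tprod _ (rankOne ρ).conj_symm, tensorFunctional_tprod, map_prod]
      simp only [rankOne, LinearMap.mk₂'ₛₗ_apply, Finset.prod_mul_distrib,
        ContinuousLinearMap.coe_coe]
      ring
    | add Y Y' h h' => simp only [map_add, h, h', mul_add]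
  | add X X' h h' => simp only [map_add, LinearMap.add_apply, h, h', mul_add, add_mul]

/-- The functional `δ_ρ` is continuous for every continuous `ρ`. -/
theorem exists_norm_evalAt_le (ρ : V →L[ℂ] ℂ) : ∃ C : ℝ, 0 ≤ C ∧ ∀ X : TensorSpace V,
    ‖evalAt (ρ : V →ₗ[ℂ] ℂ) X‖ ≤ C * tensorSeminorm (rankOne ρ) X := by
  have hsum : Summable fun k : ℕ => ((k ! : ℝ))⁻¹ := by
    simpa using Real.summable_pow_div_factorial 1
  have hC : 0 ≤ ∑' k : ℕ, ((k ! : ℝ))⁻¹ := tsum_nonneg fun k => by positivity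
  refine ⟨√(∑' k : ℕ, ((k ! : ℝ))⁻¹), Real.sqrt_nonneg _, fun X => ?_⟩
  obtain ⟨s, hs⟩ := exists_sum_incl X
  set a : ℕ → ℂ := fun k => tensorFunctional k (fun _ => (ρ : V →ₗ[ℂ] ℂ)) (proj k X) with ha
  have h1 : evalAt (ρ : V →ₗ[ℂ] ℂ) X = ∑ k ∈ s, a k := by
    conv_lhs => rw [hs]
    simp only [map_sum, evalAt_incl, ha]
  have h2 : (tensorForm (rankOne ρ).form X X).re = ∑ k ∈ s, k ! * ‖a k‖ ^ 2 := by
    rw [tensorForm_eq_sum _ X X s hs, Complex.re_sum]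
    refine Finset.sum_congr rfl fun k _ => ?_
    rw [degreeForm_rankOne, mul_comm ((starRingEnd ℂ) _), Complex.mul_conj, ← Complex.sq_norm]
    norm_cast
  rw [tensorSeminorm_apply, ← Real.sqrt_mul hC, h1, h2]
  refine Real.le_sqrt_of_sq_le ?_
  calc ‖∑ k ∈ s, a k‖ ^ 2 ≤ (∑ k ∈ s, ‖a k‖) ^ 2 := by
        gcongr; exact norm_sum_le _ _
    _ ≤ (∑ k ∈ s, ((k ! : ℝ))⁻¹) * ∑ k ∈ s, k ! * ‖a k‖ ^ 2 := by
        refine Finset.sum_sq_le_sum_mul_sum_of_sq_le_mul _ (fun k _ => by positivity)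
          (fun k _ => by positivity) fun k _ => le_of_eq ?_
        have : (k ! : ℝ) ≠ 0 := by exact_mod_cast k.factorial_ne_zero
        field_simp
    _ ≤ _ := by
        gcongr
        exact hsum.sum_le_tsum _ fun k _ => by positivity

theorem uniformContinuous_evalAt (ρ : V →L[ℂ] ℂ) :
    UniformContinuous (evalAt (ρ : V →ₗ[ℂ] ℂ)) := by
  obtain ⟨C, hC, h⟩ := exists_norm_evalAt_le ρ
  refine uniformContinuous_iInf_dom (i := rankOne ρ) ?_
  let := (tensorSeminorm (rankOne ρ)).toSeminormedAddCommGroup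
  exact AddMonoidHomClass.uniformContinuous_of_bound (evalAt (ρ : V →ₗ[ℂ] ℂ)) C h

/-- The Hermitian elements `V'_h` of the topological dual of `V`, with respect to an antilinear
map `J` on `V` (the involution): the real vector space of all continuous linear functionals `ρ`
with `conj (ρ v) = ρ (J v)`. -/
def hermDual (J : V →L⋆[ℂ] V) : Submodule ℝ (V →L[ℂ] ℂ) where
  carrier := {ρ | ∀ v, (starRingEnd ℂ) (ρ v) = ρ (J v)}
  add_mem' h h' v := by simp [h v, h' v]
  zero_mem' v := by simp
  smul_mem' c ρ h v := by simp [h v]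

/-- The Gel'fand transform `X̂` of an element `X` of the completion of the symmetric tensors: the
function on `V'_h` that maps `ρ` to the value at `X` of the continuous extension of `δ_ρ`. -/
def gelfand (J : V →L⋆[ℂ] V) (X : SymTensorCpl V) (ρ : hermDual J) : ℂ :=
  UniformSpace.Completion.extension
    (fun Y : SymTensor V => evalAt ((ρ : V →L[ℂ] ℂ) : V →ₗ[ℂ] ℂ) Y) X

theorem gelfand_coe (J : V →L⋆[ℂ] V) (Y : SymTensor V) (ρ : hermDual J) :
    gelfand J Y ρ = evalAt ((ρ : V →L[ℂ] ℂ) : V →ₗ[ℂ] ℂ) Y :=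
  UniformSpace.Completion.extension_coe
    ((uniformContinuous_evalAt (ρ : V →L[ℂ] ℂ)).comp uniformContinuous_subtype_val) Y

theorem continuous_gelfand (J : V →L⋆[ℂ] V) (ρ : hermDual J) :
    Continuous fun X : SymTensorCpl V => gelfand J X ρ :=
  UniformSpace.Completion.continuous_extension

end Gelfand

end HilbertTensor

namespace HilbertTensor

section Power

variable {V : Type*} [NormedAddCommGroup V] [InnerProductSpace ℂ V]

/-- The inner product of `V` as a continuous positive Hermitian form. -/
def innerForm (V : Type*) [NormedAddCommGroup V] [InnerProductSpace ℂ V] : PosHermForm V where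
  form := innerₛₗ ℂ
  conj_symm v w := by simp
  nonneg v := by simpa using inner_self_nonneg (𝕜 := ℂ) (x := v)
  continuous' := by simpa using continuous_inner (𝕜 := ℂ) (E := V)

theorem norm_tensorForm_le (α : PosHermForm V) (X Y : TensorSpace V) :
    ‖tensorForm α.form X Y‖ ≤ tensorSeminorm α X * tensorSeminorm α Y := by
  let := tensorCore α
  exact InnerProductSpace.Core.norm_inner_le_norm (𝕜 := ℂ) X Y

theorem tensorForm_incl_left (α : V →ₗ⋆[ℂ] V →ₗ[ℂ] ℂ) (k : ℕ) (x : ⨂[ℂ]^k V)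
    (Y : TensorSpace V) : tensorForm α (incl k x) Y = degreeForm α k x (proj k Y) := by
  obtain ⟨s, hs⟩ := exists_sum_incl Y
  rw [hs]
  simp only [map_sum, tensorForm_incl]
  refine Finset.sum_congr rfl fun l _ => ?_
  rcases eq_or_ne k l with rfl | h
  · simp only [proj_incl_self]
  · rw [proj_incl_ne h, proj_incl_ne h.symm]; simp

theorem degreeForm_tprod_left (α : PosHermForm V) (k : ℕ) (x : Fin k → V) (Y : ⨂[ℂ]^k V) :
    degreeForm α.form k (PiTensorProduct.tprod ℂ x) Y =
      k ! * tensorFunctional k (fun m => α.form (x m)) Y := by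
  induction Y using PiTensorProduct.induction_on with
  | smul_tprod r y =>
    rw [map_smul, map_smul, degreeForm_tprod _ α.conj_symm, tensorFunctional_tprod,
      smul_eq_mul, smul_eq_mul]
    ring
  | add Y Y' h h' => simp only [map_add, h, h', mul_add]

theorem norm_tensorFunctional_proj_le [CompleteSpace V] (k : ℕ) (η : Fin k → V →L[ℂ] ℂ)
    (X : TensorSpace V) :
    ‖tensorFunctional k (fun m => (η m : V →ₗ[ℂ] ℂ)) (proj k X)‖ ≤
      tensorSeminorm (innerForm V) X / √(k ! : ℝ) * ∏ m, ‖η m‖ := by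
  set r : Fin k → V := fun m => (InnerProductSpace.toDual ℂ V).symm (η m) with hr
  have hη : (fun m => (η m : V →ₗ[ℂ] ℂ)) = fun m => (innerForm V).form (r m) := by
    ext m v
    simp [innerForm, hr]
  have h := norm_tensorForm_le (innerForm V) (incl k (PiTensorProduct.tprod ℂ r)) X
  have hn : tensorSeminorm (innerForm V) (incl k (PiTensorProduct.tprod ℂ r)) =
      √(k ! : ℝ) * ∏ m, ‖η m‖ := by
    have h1 : tensorForm (innerForm V).form (incl k (PiTensorProduct.tprod ℂ r))
        (incl k (PiTensorProduct.tprod ℂ r)) = (((k ! : ℝ) * (∏ m, ‖η m‖) ^ 2 : ℝ) : ℂ) := by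
      rw [tensorForm_incl_left, proj_incl_self, degreeForm_tprod _ (innerForm V).conj_symm,
        ← Finset.prod_pow]
      push_cast
      congr 1
      refine Finset.prod_congr rfl fun m _ => ?_
      simp [innerForm, hr, inner_self_eq_norm_sq_to_K]
    rw [tensorSeminorm_apply, h1, Complex.ofReal_re, Real.sqrt_mul (by positivity),
      Real.sqrt_sq (by positivity)]
  rw [tensorForm_incl_left, degreeForm_tprod_left, ← hη, hn, norm_mul, Complex.norm_natCast] at h
  have hk : 0 < √(k ! : ℝ) := by positivity
  have hkk : (k ! : ℝ) = √(k ! : ℝ) * √(k ! : ℝ) := (Real.mul_self_sqrt (by positivity)).symm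
  rw [div_mul_eq_mul_div, le_div_iff₀ hk]
  refine le_of_mul_le_mul_left ?_ hk
  calc √(k ! : ℝ) * (_ * √(k ! : ℝ)) = k ! * _ := by
        rw [mul_comm _ √(k ! : ℝ), ← mul_assoc, ← hkk]
    _ ≤ _ := h
    _ = _ := by ring

theorem uniformContinuous_tensorSeminorm (α : PosHermForm V) :
    UniformContinuous (tensorSeminorm α) := by
  refine uniformContinuous_iInf_dom (i := α) ?_
  let := (tensorSeminorm α).toSeminormedAddCommGroup
  exact uniformContinuous_norm

/-- The value at `X` of the continuous extension of `δ_ρ` to the completion of the symmetric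
tensors, for `ρ` in the whole dual of `V`. -/
def evalCpl (X : SymTensorCpl V) (ρ : V →L[ℂ] ℂ) : ℂ :=
  UniformSpace.Completion.extension
    (fun Y : SymTensor V => evalAt (ρ : V →ₗ[ℂ] ℂ) Y) X

theorem evalCpl_coe (Y : SymTensor V) (ρ : V →L[ℂ] ℂ) :
    evalCpl (Y : SymTensorCpl V) ρ = evalAt (ρ : V →ₗ[ℂ] ℂ) Y :=
  UniformSpace.Completion.extension_coe
    ((uniformContinuous_evalAt ρ).comp uniformContinuous_subtype_val) Y

theorem continuous_evalCpl (ρ : V →L[ℂ] ℂ) :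
    Continuous fun X : SymTensorCpl V => evalCpl X ρ :=
  UniformSpace.Completion.continuous_extension

/-- The continuous extension of the seminorm of the inner product to the completion. -/
def seminormCpl (X : SymTensorCpl V) : ℝ :=
  UniformSpace.Completion.extension
    (fun Y : SymTensor V => tensorSeminorm (innerForm V) Y) X

theorem seminormCpl_coe (Y : SymTensor V) :
    seminormCpl (Y : SymTensorCpl V) = tensorSeminorm (innerForm V) Y :=
  UniformSpace.Completion.extension_coe
    ((uniformContinuous_tensorSeminorm (innerForm V)).comp uniformContinuous_subtype_val) Y

theorem continuous_seminormCpl : Continuous (seminormCpl (V := V)) :=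
  UniformSpace.Completion.continuous_extension

theorem summable_pow_div_sqrt_factorial (x : ℝ) : Summable fun k : ℕ => x ^ k / √(k ! : ℝ) := by
  have h1 : Summable fun k : ℕ => (2 * x ^ 2) ^ k / (k ! : ℝ) :=
    Real.summable_pow_div_factorial _
  have h2 : Summable fun k : ℕ => ((1 / 2 : ℝ)) ^ k := summable_geometric_two
  refine Summable.of_norm_bounded (h1.add h2) fun k => ?_
  have hk : 0 < √(k ! : ℝ) := by positivity
  have e1 : (2 * x ^ 2) ^ k / (k ! : ℝ) = 2 ^ k * (|x| ^ k / √(k ! : ℝ)) ^ 2 := by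
    rw [div_pow, Real.sq_sqrt (by positivity), mul_pow, ← pow_mul, ← pow_mul, mul_comm k 2,
      pow_mul |x|, sq_abs, ← pow_mul]
    ring
  rw [e1, norm_div, norm_pow, Real.norm_eq_abs, Real.norm_of_nonneg hk.le]
  set y := |x| ^ k / √(k ! : ℝ)
  have e2 : (1 / 2 : ℝ) ^ k * 2 ^ k = 1 := by rw [← mul_pow]; norm_num
  have p1 : (0 : ℝ) < 2 ^ k := by positivity
  have p2 : (0 : ℝ) < (1 / 2) ^ k := by positivity
  have hy : 0 ≤ y := by positivity
  have e3 : 2 ^ k * y ^ 2 + (1 / 2) ^ k - y =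
      2 ^ k * (y - (1 / 2) ^ k) ^ 2 + y := by
    linear_combination (2 * y - (1 / 2) ^ k) * e2
  linarith [mul_nonneg p1.le (sq_nonneg (y - (1 / 2) ^ k))]

theorem evalAt_eq_sum (ρ : V →ₗ[ℂ] ℂ) (X : TensorSpace V) : ∃ n : ℕ, ∀ m, n ≤ m →
    evalAt ρ X = ∑ k ∈ Finset.range m, tensorFunctional k (fun _ => ρ) (proj k X) := by
  obtain ⟨s, hs⟩ := exists_sum_incl X
  refine ⟨s.sup id + 1, fun m hm => ?_⟩
  have h1 : evalAt ρ X = ∑ k ∈ s, tensorFunctional k (fun _ => ρ) (proj k X) := by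
    conv_lhs => rw [hs]
    simp only [map_sum, evalAt_incl]
  rw [h1]
  refine Finset.sum_subset (fun k hk => Finset.mem_range.2
    ((Nat.lt_succ_of_le (Finset.le_sup (f := id) hk)).trans_le hm)) fun k _ hk => ?_
  have h2 : proj k X = 0 := by
    rw [hs, map_sum]
    exact Finset.sum_eq_zero fun l hl => proj_incl_ne (ne_of_mem_of_not_mem hl hk) _
  rw [h2, map_zero]

variable [CompleteSpace V]

/-- For `X ∈ ⨁ k, V^{⊗ k}`, the continuous multilinear map on the dual of `V` with
`(ρ₁, …, ρ_k) ↦ (ρ₁ ⊗ ⋯ ⊗ ρ_k) (X_k)`: the homogeneous part of degree `k` of the function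
`ρ ↦ δ_ρ (X)`. -/
def homogeneousPart (k : ℕ) : TensorSpace V →+ (V →L[ℂ] ℂ) [×k]→L[ℂ] ℂ :=
  AddMonoidHom.mk' (fun X =>
    MultilinearMap.mkContinuous
      (((LinearMap.applyₗ (proj k X)).compMultilinearMap (tensorFunctional k)).compLinearMap
          fun _ => ContinuousLinearMap.coeLM (M := V) (N₃ := ℂ) (R := ℂ) ℂ)
      (tensorSeminorm (innerForm V) X / √(k ! : ℝ))
      fun ρ => norm_tensorFunctional_proj_le k ρ X) fun X Y => by
    ext ρ
    exact (congrArg _ (map_add (proj k) X Y)).trans (map_add (tensorFunctional k _) _ _)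

theorem homogeneousPart_apply (k : ℕ) (X : TensorSpace V) (ρ : Fin k → V →L[ℂ] ℂ) :
    homogeneousPart k X ρ =
      tensorFunctional k (fun m => (ρ m : V →ₗ[ℂ] ℂ)) (proj k X) := rfl

theorem norm_homogeneousPart_le (k : ℕ) (X : TensorSpace V) :
    ‖homogeneousPart k X‖ ≤ tensorSeminorm (innerForm V) X / √(k ! : ℝ) :=
  MultilinearMap.mkContinuous_norm_le _ (div_nonneg (apply_nonneg _ _) (Real.sqrt_nonneg _))
    fun ρ => norm_tensorFunctional_proj_le k ρ X

theorem uniformContinuous_homogeneousPart (k : ℕ) :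
    UniformContinuous (homogeneousPart (V := V) k) := by
  refine uniformContinuous_iInf_dom (i := innerForm V) ?_
  let := (tensorSeminorm (innerForm V)).toSeminormedAddCommGroup
  refine AddMonoidHomClass.uniformContinuous_of_bound (homogeneousPart (V := V) k)
    (√(k ! : ℝ))⁻¹
    fun X => ?_
  rw [inv_mul_eq_div]
  exact norm_homogeneousPart_le k X

theorem norm_evalAt_sub_sum_le (X : TensorSpace V) (ρ : V →L[ℂ] ℂ) (n : ℕ) :
    ‖evalAt (ρ : V →ₗ[ℂ] ℂ) X -
        ∑ k ∈ Finset.range n, homogeneousPart k X fun _ => ρ‖ ≤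
      tensorSeminorm (innerForm V) X * ∑' k, ‖ρ‖ ^ (k + n) / √((k + n)! : ℝ) := by
  obtain ⟨m, hm⟩ := evalAt_eq_sum (ρ : V →ₗ[ℂ] ℂ) X
  have hs := (summable_nat_add_iff n).2 (summable_pow_div_sqrt_factorial ‖ρ‖)
  rw [hm (n + m) (Nat.le_add_left _ _), Finset.sum_range_add]
  simp only [homogeneousPart_apply, add_sub_cancel_left]
  refine (norm_sum_le _ _).trans ?_
  rw [← tsum_mul_left]
  refine le_trans (Finset.sum_le_sum fun k _ => ?_)
    ((hs.mul_left (tensorSeminorm (innerForm V) X)).sum_le_tsum (Finset.range m) fun k _ => ?_)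
  · refine (norm_tensorFunctional_proj_le (n + k) (fun _ => ρ) X).trans_eq ?_
    rw [Finset.prod_const, Finset.card_univ, Fintype.card_fin, add_comm n k, div_mul_eq_mul_div,
      mul_div_assoc]
  · positivity

/-- The power series at `0` of `ρ ↦ δ_ρ (X)`, for `X` in the completion. -/
def evalSeries (X : SymTensorCpl V) : FormalMultilinearSeries ℂ (V →L[ℂ] ℂ) ℂ := fun k =>
  UniformSpace.Completion.extension (fun Y : SymTensor V => homogeneousPart k Y) X

theorem evalSeries_coe (Y : SymTensor V) (k : ℕ) :
    evalSeries (Y : SymTensorCpl V) k = homogeneousPart k Y :=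
  UniformSpace.Completion.extension_coe
    ((uniformContinuous_homogeneousPart k).comp uniformContinuous_subtype_val) Y

theorem continuous_evalSeries (k : ℕ) :
    Continuous fun X : SymTensorCpl V => evalSeries X k :=
  UniformSpace.Completion.continuous_extension

theorem norm_evalSeries_le (X : SymTensorCpl V) (k : ℕ) :
    ‖evalSeries X k‖ ≤ seminormCpl X / √(k ! : ℝ) := by
  induction X using UniformSpace.Completion.induction_on with
  | hp =>
    have hn : Continuous fun q : (V →L[ℂ] ℂ) [×k]→L[ℂ] ℂ => ‖q‖ :=
      continuous_norm (E := (V →L[ℂ] ℂ) [×k]→L[ℂ] ℂ)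
    exact isClosed_le (hn.comp (continuous_evalSeries k))
      (continuous_seminormCpl.div_const _)
  | ih Y =>
    rw [evalSeries_coe, seminormCpl_coe]
    exact norm_homogeneousPart_le k (Y : TensorSpace V)

theorem norm_evalCpl_sub_sum_le (X : SymTensorCpl V) (ρ : V →L[ℂ] ℂ) (n : ℕ) :
    ‖evalCpl X ρ - ∑ k ∈ Finset.range n, evalSeries X k fun _ => ρ‖ ≤
      seminormCpl X * ∑' k, ‖ρ‖ ^ (k + n) / √((k + n)! : ℝ) := by
  induction X using UniformSpace.Completion.induction_on with
  | hp =>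
    refine isClosed_le (((continuous_evalCpl ρ).sub
      (continuous_finsetSum _ fun k _ => ?_)).norm) (continuous_seminormCpl.mul_const _)
    exact (ContinuousMultilinearMap.apply ℂ (fun _ : Fin k => V →L[ℂ] ℂ) ℂ
      fun _ => ρ).continuous.comp (continuous_evalSeries k)
  | ih Y =>
    simp only [evalSeries_coe, seminormCpl_coe, evalCpl_coe]
    exact norm_evalAt_sub_sum_le (Y : TensorSpace V) ρ n

theorem summable_norm_evalSeries (X : SymTensorCpl V) (x : ℝ) (hx : 0 ≤ x) :
    Summable fun k => ‖evalSeries X k‖ * x ^ k := by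
  refine Summable.of_nonneg_of_le (fun k => by positivity) (fun k => ?_)
    ((summable_pow_div_sqrt_factorial x).mul_left (seminormCpl X))
  calc ‖evalSeries X k‖ * x ^ k ≤ seminormCpl X / √(k ! : ℝ) * x ^ k := by
        gcongr; exact norm_evalSeries_le X k
    _ = _ := by ring

theorem hasFPowerSeriesOnBall_evalCpl (X : SymTensorCpl V) :
    HasFPowerSeriesOnBall (evalCpl X) (evalSeries X) 0 ⊤ where
  r_le := by
    refine ENNReal.le_of_forall_nnreal_lt fun r _ => ?_
    exact (evalSeries X).le_radius_of_summable
      (summable_norm_evalSeries X r r.coe_nonneg)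
  r_pos := ENNReal.zero_lt_top
  hasSum {ρ} _ := by
    rw [zero_add]
    have hs : Summable fun k => evalSeries X k fun _ => ρ :=
      Summable.of_norm_bounded (summable_norm_evalSeries X ‖ρ‖ (norm_nonneg _)) fun k => by
        simpa using (evalSeries X k).le_opNorm fun _ => ρ
    refine hs.hasSum_iff_tendsto_nat.2 ?_
    rw [tendsto_iff_norm_sub_tendsto_zero]
    have ht := (tendsto_sum_nat_add fun k : ℕ => ‖ρ‖ ^ k / √(k ! : ℝ)).const_mul (seminormCpl X)
    rw [mul_zero] at ht
    refine squeeze_zero (fun _ => norm_nonneg _) (fun n => ?_) ht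
    rw [norm_sub_rev]
    exact norm_evalCpl_sub_sum_le X ρ n

end Power

end HilbertTensor

/-- Let `V` be a complex Hilbert space with a continuous antilinear involution `J` that is
compatible with the inner product. Then the Gel'fand transform of every element of the completion
of the symmetric tensors is a smooth function, in the Fréchet sense, on the real Banach space
`V'_h` of Hermitian continuous linear functionals. -/
theorem theorem4p2 {V : Type*} [NormedAddCommGroup V] [InnerProductSpace ℂ V] [CompleteSpace V]
    (J : V →L⋆[ℂ] V) (hJ : Function.Involutive J)
    (hJV : ∀ v w : V, (starRingEnd ℂ) (inner ℂ v w) = inner ℂ (J v) (J w))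
    (X : HilbertTensor.SymTensorCpl V) :
    ContDiff ℝ ((⊤ : ℕ∞) : WithTop ℕ∞) (HilbertTensor.gelfand J X) := by
  have h := (HilbertTensor.hasFPowerSeriesOnBall_evalCpl X).analyticOnNhd
  rw [Metric.eball_top] at h
  have h' : ContDiff ℂ ((⊤ : ℕ∞) : WithTop ℕ∞) (HilbertTensor.evalCpl X) := h.contDiff
  exact (h'.restrict_scalars ℝ).comp <|
    LinearIsometry.contDiff (𝕜 := ℝ) (E := HilbertTensor.hermDual J) (F := V →L[ℂ] ℂ)
      (Submodule.subtypeₗᵢ (HilbertTensor.hermDual J))
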